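/- Let $m\ge 1$, let $R_\theta$ be the rotation of $\mathbb R^2$ by $\theta$, and let $S=\{R_{2\pi k/m}: k=0,\dots,m-1\}$. Let $\delta>0$ be the mesh size and $p\ge1$ the filter size. An image $I\in\mathbb R^{h\times w\times n_0}$ is the sampling, at the pixels of the centred grid, of latent functions $r_c:\mathbb R^2\to\mathbb R$, $1\le c\le n_0$, and $\pi^I_{R_\theta}$ replaces $r_c$ by $r_c(R_\theta^{-1}\,\cdot)$; a feature map consists of functions $e_c:\mathbb R^2\times S\to\mathbb R$. Consider the network $$\mathrm{ReDiffuse}=\hat\Upsilon\circ\Phi_{\mathrm{BI}}^{(s)}\circ\cdots\circ\Phi_{\mathrm{BI}}^{(1)}\circ\hat{\mathcal F}\circ\Phi_{\mathrm{MP}}^{(s)}\circ\cdots\circ\Phi_{\mathrm{MP}}^{(1)}\circ\hat\Psi ,$$ where $\hat\Psi,\hat{\mathcal F},\hat\Upsilon$ consist of $a+1$, $b$ and $d+1$ convolution layers ($a,b,d,s\ge 0$), $N=a+b+d+2$ layers in total. Write $y$ for the $p^2$ points of the centred $p\times p$ grid of mesh $\delta$. The first layer is $(c,R,x)\mapsto\sum_{c',y}\phi_{c,c'}(R^{-1}y)\,r_{c'}(x-y)$,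 the hidden layers are $(c,R,x)\mapsto\sum_{c',A\in S,y}\phi_{c,c',A}(R^{-1}y)\,e_{c'}(x-y,RA)$, and the last one is $(c,x)\mapsto\sum_{c',A\in S,y}\phi_{c,c'}(A^{-1}y)\,e_{c'}(x-y,A)$, each with its own latent filters $\phi_l$. In front of each convolution there may be a group normalization over the channels at each $(x,R)$, $v\mapsto\gamma\odot(v-\mu)/\sqrt{\sigma^2+\varepsilon}+\beta$ with $\varepsilon>0$ ($\mu,\sigma^2$ the mean and variance over the channel group), followed by a SiLU $t\mapsto t/(1+e^{-t})$; each of the two may be absent. With $\Omega_x$ the corners $(\lfloor x_1/\delta\rfloor+v,\lfloor x_2/\delta\rfloor+u)\delta$, $u,v\in\{0,1\}$, of the grid cell of $x$, $\Phi_{\mathrm{MP}}(e)(x,R)=\max_{q\in\Omega_x}e(q,R)$ and $\Phi_{\mathrm{BI}}(e)(x,R)=\sum_{q\in\Omega_x}\lambda_q(x)e(q,R)$ with weights $\lambda_q(x)\ge0$, $\sum_q\lambda_q(x)=1$. Let $n_0$ be the number of channels of $I$ and, for $1\le l<N$, let $n_l$ be the number of channels after layer $l$, counted over all orientations ($n_l=m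 k_l$ with $k_l$ channels per orientation, $k_l\ge1$; $k_0=n_0\ge1$). Assume that all $r_c$ and all filters $\phi_l$ of layer $l$, $1\le l\le N$, are twice differentiable and that for all $x\in\mathbb R^2$ $$|r_c(x)|\le F_0,\quad\|\nabla r_c(x)\|\le G_0,\quad\|\nabla^2r_c(x)\|\le H_0,\qquad|\phi_l(x)|\le F_l,\quad\|\nabla\phi_l(x)\|\le G_l,\quad\|\nabla^2\phi_l(x)\|\le H_l,$$ and $\phi_l(x)=0$ whenever $\|x\|\ge(p+1)\delta/2$. Then for every $\theta\in[0,2\pi]$, in every output channel and at every pixel, $$\bigl|\mathrm{ReDiffuse}(\pi^I_{R_\theta}(I))-\pi^I_{R_\theta}[\mathrm{ReDiffuse}](I)\bigr|\le C_1\delta+C_2m^{-1}\delta ,$$ where $$C_1=\sqrt2\,\bigl(N(p-1)+2sb+4s(d+1)+4s^2+2s\bigr)\,G_0\,\mathcal P,\qquad C_2=\pi\sqrt{h^2+w^2}\;G_0\,\mathcal P,\qquad \mathcal P=\prod_{l=1}^N n_{l-1}\,p^2F_l\,\Lambda_{l-1}.$$ Here $\Lambda_{l}$ is the product of $(2+\sqrt{k_l})\max_c|\gamma_c|/\sqrt{\varepsilon}$,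 if there is a group normalization in front of layer $l+1$, and of $5/4$, if there is a SiLU in front of it ($\Lambda_l=1$ if neither is present). -/

import Mathlib

open scoped BigOperators

noncomputable section

namespace ReDiffuse

/-- The image plane. -/
abbrev Plane : Type := EuclideanSpace ℝ (Fin 2)

/-- The rotation matrix `R_θ` (rows `(cos θ, -sin θ)` and `(sin θ, cos θ)`) applied to `x`. -/
def rot (θ : ℝ) (x : Plane) : Plane :=
  !₂[Real.cos θ * x 0 - Real.sin θ * x 1, Real.sin θ * x 0 + Real.cos θ * x 1]

/-- A multi-channel image, given by its latent functions. -/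
abbrev Image (n : ℕ) : Type := Fin n → Plane → ℝ

/-- A feature map with `n` channels per orientation, given by its latent functions
`x ↦ e_c(x, R_g)`.  The index `g : ZMod m` stands for the rotation `R_g` by `2πg/m`, so that
addition in `ZMod m` is composition in the rotation group `S` of order `m`. -/
abbrev Feature (m n : ℕ) : Type := Fin n → ZMod m → Plane → ℝ

/-- The angle `2πg/m` of the element `R_g` of the rotation group of order `m`. -/
def groupAngle {m : ℕ} (g : ZMod m) : ℝ := 2 * Real.pi * (g.val : ℝ) / (m : ℝ)

/-- The action `π^I_{R_θ}` on images: `(π^I_{R_θ} r)_c (x) = r_c (R_θ⁻¹ x)`. -/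
def rotateImage {n : ℕ} (θ : ℝ) (r : Image n) : Image n := fun c x => r c (rot (-θ) x)

/-- The nodes of a centred grid of mesh size `δ`, of width `w` (first index) and `h` (second). -/
def gridPoint (δ : ℝ) {w h : ℕ} (u : Fin w) (v : Fin h) : Plane :=
  !₂[((u : ℝ) - ((w : ℝ) - 1) / 2) * δ, ((v : ℝ) - ((h : ℝ) - 1) / 2) * δ]

/-- `f` is twice differentiable, with `|f| ≤ F`, `‖∇f‖ ≤ G` and `‖∇²f‖ ≤ H` everywhere. -/
def HasBounds (F G H : ℝ) (f : Plane → ℝ) : Prop :=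
  Differentiable ℝ f ∧ Differentiable ℝ (gradient f) ∧
    ∀ x, |f x| ≤ F ∧ ‖gradient f x‖ ≤ G ∧ ‖fderiv ℝ (gradient f) x‖ ≤ H

/-- A latent filter of size `p` at mesh size `δ`: bounds as above, and support condition. -/
def IsFilter (p : ℕ) (δ F G H : ℝ) (f : Plane → ℝ) : Prop :=
  HasBounds F G H f ∧ ∀ x, ((p : ℝ) + 1) * δ / 2 ≤ ‖x‖ → f x = 0

/-! ### Group convolutions with `p × p` filters sampled from rotated latent filters -/

/-- Input layer: from images to feature maps,
`(c, R, x) ↦ ∑_{c', y} ψ_{c,c'}(R⁻¹ y) r_{c'}(x - y)`. -/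
def liftConv {m n n' : ℕ} (p : ℕ) (δ : ℝ) (ψ : Fin n' → Fin n → Plane → ℝ) (r : Image n) :
    Feature m n' :=
  fun c g x => ∑ c' : Fin n, ∑ u : Fin p, ∑ v : Fin p,
    ψ c c' (rot (-groupAngle g) (gridPoint δ u v)) * r c' (x - gridPoint δ u v)

/-- Hidden layer: from feature maps to feature maps,
`(c, R, x) ↦ ∑_{c', A, y} φ_{c,c',A}(R⁻¹ y) f_{c'}(x - y, R A)`. -/
def groupConv {m n n' : ℕ} [NeZero m] (p : ℕ) (δ : ℝ)
    (φ : Fin n' → Fin n → ZMod m → Plane → ℝ) (f : Feature m n) : Feature m n' :=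
  fun c g x => ∑ c' : Fin n, ∑ A : ZMod m, ∑ u : Fin p, ∑ v : Fin p,
    φ c c' A (rot (-groupAngle g) (gridPoint δ u v)) * f c' (g + A) (x - gridPoint δ u v)

/-- Output layer: from feature maps to images,
`(c, x) ↦ ∑_{c', A, y} υ_{c,c'}(A⁻¹ y) f_{c'}(x - y, A)`. -/
def projConv {m n n' : ℕ} [NeZero m] (p : ℕ) (δ : ℝ) (υ : Fin n' → Fin n → Plane → ℝ)
    (f : Feature m n) : Image n' :=
  fun c x => ∑ c' : Fin n, ∑ A : ZMod m, ∑ u : Fin p, ∑ v : Fin p,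
    υ c c' (rot (-groupAngle A) (gridPoint δ u v)) * f c' A (x - gridPoint δ u v)

/-! ### Group normalization and SiLU, acting on the channel vector at one `(x, R)` -/

/-- The SiLU activation `t / (1 + e^{-t})`. -/
def silu (t : ℝ) : ℝ := t / (1 + Real.exp (-t))

/-- The data of a group normalization of `n` channels; channels with the same label form one
channel group. -/
structure GroupNorm (n : ℕ) where
  label : Fin n → ℕ
  γ : Fin n → ℝ
  β : Fin n → ℝ
  ε : ℝ
  ε_pos : 0 < ε

namespace GroupNorm

variable {n : ℕ} (N : GroupNorm n)

/-- The channel group containing the channel `c`. -/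
def group (c : Fin n) : Finset (Fin n) := Finset.univ.filter fun c' => N.label c' = N.label c

/-- The mean over the channel group of `c`. -/
def mean (v : Fin n → ℝ) (c : Fin n) : ℝ := (∑ c' ∈ N.group c, v c') / ((N.group c).card : ℝ)

/-- The variance over the channel group of `c`. -/
def variance (v : Fin n → ℝ) (c : Fin n) : ℝ :=
  (∑ c' ∈ N.group c, (v c' - N.mean v c) ^ 2) / ((N.group c).card : ℝ)

/-- `γ ⊙ (v - μ) / √(σ² + ε) + β`. -/
def apply (v : Fin n → ℝ) : Fin n → ℝ :=
  fun c => N.γ c * ((v c - N.mean v c) / Real.sqrt (N.variance v c + N.ε)) + N.β c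

/-- The constant `(2 + √n) max_c |γ_c| / √ε`; `‖·‖` is the sup norm. -/
def lip : ℝ := (2 + Real.sqrt (n : ℝ)) * ‖N.γ‖ / Real.sqrt N.ε

end GroupNorm

/-- The pointwise operation in front of a convolution: group normalization, then SiLU, where each
of the two may be absent. -/
structure PreAct (n : ℕ) where
  gn : Option (GroupNorm n)
  act : Bool

namespace PreAct

variable {n : ℕ} (P : PreAct n)

def apply (v : Fin n → ℝ) : Fin n → ℝ := fun c =>
  let w : Fin n → ℝ := match P.gn with
    | none => v
    | some N => N.apply v
  if P.act then silu (w c) else w c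

/-- The constant `Λ`: the product of `(2 + √n) max |γ| / √ε` if there is a group normalization
and of `5/4` if there is a SiLU. -/
def lip : ℝ :=
  (match P.gn with
    | none => 1
    | some N => N.lip) * (if P.act then 5 / 4 else 1)

def onImage (r : Image n) : Image n := fun c x => P.apply (fun c' => r c' x) c

def onFeature {m : ℕ} (f : Feature m n) : Feature m n :=
  fun c g x => P.apply (fun c' => f c' g x) c

end PreAct

/-! ### Downsampling and upsampling -/

/-- The corner `(⌊x₁/δ⌋ + v, ⌊x₂/δ⌋ + u)` of the grid cell of mesh size `δ` that contains `x`,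
as a point of the plane. -/
def corner (δ : ℝ) (x : Plane) (v u : Fin 2) : Plane :=
  !₂[((⌊x 0 / δ⌋ : ℝ) + ((v : ℕ) : ℝ)) * δ, ((⌊x 1 / δ⌋ : ℝ) + ((u : ℕ) : ℝ)) * δ]

/-- Maxpooling: the maximum over the four corners of the cell containing `x`. -/
def maxPool {m n : ℕ} (δ : ℝ) (f : Feature m n) : Feature m n :=
  fun c g x => (Finset.univ : Finset (Fin 2 × Fin 2)).sup' Finset.univ_nonempty
    fun q => f c g (corner δ x q.1 q.2)

/-- Interpolation weights `λ_{vu}(x) ≥ 0` with `∑ λ_{vu}(x) = 1`. -/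
structure Weights where
  lam : Fin 2 → Fin 2 → Plane → ℝ
  nonneg : ∀ v u x, 0 ≤ lam v u x
  sum_eq_one : ∀ x, ∑ v : Fin 2, ∑ u : Fin 2, lam v u x = 1

/-- Bilinear interpolation: the weighted mean of the corners of the cell containing `x`. -/
def interp {m n : ℕ} (δ : ℝ) (W : Weights) (f : Feature m n) : Feature m n :=
  fun c g x => ∑ v : Fin 2, ∑ u : Fin 2, W.lam v u x * f c g (corner δ x v u)

/-- `Φ_MP^(s) ∘ ⋯ ∘ Φ_MP^(1)`. -/
def maxPools {m n : ℕ} (δ : ℝ) (s : ℕ) (f : Feature m n) : Feature m n := (maxPool δ)^[s] f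

/-- `Φ_BI^(s) ∘ ⋯ ∘ Φ_BI^(1)`. -/
def interps {m n : ℕ} (δ : ℝ) (W : ℕ → Weights) (f : Feature m n) : ℕ → Feature m n
  | 0 => f
  | s + 1 => interp δ (W (s + 1)) (interps δ W f s)

/-! ### The network -/

/-- Number of convolution layers: `a + 1` in the input stage (the first one lifts the image to a
feature map), `b` in the middle stage and `d + 1` in the output stage (the last one returns to
images). -/
def numLayers (a b d : ℕ) : ℕ := 1 + a + b + d + 1

/-- The parameters of a network.  `ch 0` and `ch (numLayers a b d)` are the numbers of channels of
the input and output images; for `l` in between, `ch l` is the number of channels per orientation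
of the feature map after layer `l`.  The operation `pre l` and the filter `φ l` belong to
convolution layer `l + 1`. -/
structure Network (m a b d : ℕ) (ch : ℕ → ℕ) where
  pre : (l : ℕ) → PreAct (ch l)
  ψ : Fin (ch 1) → Fin (ch 0) → Plane → ℝ
  φ : (l : ℕ) → Fin (ch (l + 1)) → Fin (ch l) → ZMod m → Plane → ℝ
  υ : Fin (ch (numLayers a b d)) → Fin (ch (1 + a + b + d)) → Plane → ℝ
  weights : ℕ → Weights

namespace Network

variable {m a b d : ℕ} {ch : ℕ → ℕ} [NeZero m] (net : Network m a b d ch) (p : ℕ) (δ : ℝ)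

/-- The hidden layers `s + 1, …, s + t`, applied to a feature map after layer `s`. -/
def layers (s : ℕ) (f : Feature m (ch s)) : (t : ℕ) → Feature m (ch (s + t))
  | 0 => f
  | t + 1 => groupConv p δ (net.φ (s + t)) ((net.pre (s + t)).onFeature (layers s f t))

/-- The convolutions `Ψ̂` of the input stage. -/
def inputStage (r : Image (ch 0)) : Feature m (ch (1 + a)) :=
  net.layers p δ 1 (liftConv p δ net.ψ ((net.pre 0).onImage r)) a

/-- The convolutions `F̂` of the middle stage. -/
def middleStage (f : Feature m (ch (1 + a))) : Feature m (ch (1 + a + b)) :=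
  net.layers p δ (1 + a) f b

/-- The convolutions `Υ̂` of the output stage. -/
def outputStage (f : Feature m (ch (1 + a + b))) : Image (ch (numLayers a b d)) :=
  projConv p δ net.υ ((net.pre (1 + a + b + d)).onFeature (net.layers p δ (1 + a + b) f d))

/-- `Υ̂ ∘ Φ_BI^(s) ∘ ⋯ ∘ Φ_BI^(1) ∘ F̂ ∘ Φ_MP^(s) ∘ ⋯ ∘ Φ_MP^(1) ∘ Ψ̂`. -/
def eval (s : ℕ) (r : Image (ch 0)) : Image (ch (numLayers a b d)) :=
  net.outputStage p δ
    (interps δ net.weights (net.middleStage p δ (maxPools δ s (net.inputStage p δ r))) s)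

/-- Every filter of layer `l` has size `p` and is bounded by `F l`, `G l`, `H l`. -/
def FiltersBounded (F G H : ℕ → ℝ) : Prop :=
  (∀ c c', IsFilter p δ (F 1) (G 1) (H 1) (net.ψ c c')) ∧
  (∀ l, 1 ≤ l → l + 1 < numLayers a b d → ∀ c c' A,
    IsFilter p δ (F (l + 1)) (G (l + 1)) (H (l + 1)) (net.φ l c c' A)) ∧
  (∀ c c', IsFilter p δ (F (numLayers a b d)) (G (numLayers a b d)) (H (numLayers a b d))
    (net.υ c c'))

end Network

/-! ### The constants -/

/-- `∏_{l=1}^{N} n_{l-1} p² F_l Λ_l`. -/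
def gain (N p : ℕ) (n : ℕ → ℕ) (F Λ : ℕ → ℝ) : ℝ :=
  ∏ l ∈ Finset.range N, (n l : ℝ) * (p : ℝ) ^ 2 * F (l + 1) * Λ l

/-- `C₁ = √2 (N(p-1) + 2sb + 4s(d+1) + 4s² + 2s) G₀ ∏_{l=1}^{N} n_{l-1} p² F_l Λ_l`, with
`N = a + b + d + 2`. -/
def C₁ (a b d s p : ℕ) (n : ℕ → ℕ) (F : ℕ → ℝ) (G₀ : ℝ) (Λ : ℕ → ℝ) : ℝ :=
  Real.sqrt 2 *
    ((numLayers a b d : ℝ) * ((p : ℝ) - 1) + 2 * s * b + 4 * s * (d + 1) + 4 * s ^ 2 + 2 * s) *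
    G₀ * gain (numLayers a b d) p n F Λ

/-- `C₂ = π √(h² + w²) G₀ ∏_{l=1}^{N} n_{l-1} p² F_l Λ_l`. -/
def C₂ (N h w p : ℕ) (n : ℕ → ℕ) (F : ℕ → ℝ) (G₀ : ℝ) (Λ : ℕ → ℝ) : ℝ :=
  Real.pi * Real.sqrt ((h : ℝ) ^ 2 + (w : ℝ) ^ 2) * G₀ * gain N p n F Λ

end ReDiffuse

end

namespace ReDiffuse

/-! ### Lipschitz bounds for the pointwise operations -/

/-! The estimate is a locality and Lipschitz argument, with no equivariance of the individual
layers. The value of the network at `x` depends only on the input within distance `ρ = N·√2(p-1)δ/2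
+ 2s·√2δ` of `x`: a convolution reaches at most as far as a corner of its grid, a pooling or
interpolation at most a cell diagonal. In `CloseNear` two points range independently over two balls.
Each layer propagates this relation, shrinking the radius by its reach; convolution layer `l`, with
its preceding pointwise operation, multiplies the discrepancy by `n_{l-1} p² F_l Λ_{l-1}`, while
pooling and interpolation preserve it. Both evaluations use the same filter samples at the same
orientation index, so rotated filters never have to be matched. The rotated image near `x` and the
original one near `R_θ⁻¹x` are values of `r_c` on one common ball, hence differ by at most `2ρG₀`.
The result is `√2(N(p-1) + 4s)G₀𝒫δ ≤ C₁δ`. The weight is carried by `Network.closeNear_eval` and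
`HasBounds.closeNear_rotateImage`; `PreAct.abs_apply_sub_le` supplies the factors `Λ`. -/

theorem hasDerivAt_silu (t : ℝ) :
    HasDerivAt silu ((1 + Real.exp (-t) + t * Real.exp (-t)) / (1 + Real.exp (-t)) ^ 2) t := by
  have hne : 1 + Real.exp (-t) ≠ 0 := by positivity
  have h1 : HasDerivAt (fun t : ℝ => 1 + Real.exp (-t)) (-Real.exp (-t)) t := by
    simpa using ((hasDerivAt_neg t).exp).const_add 1
  refine ((hasDerivAt_id t).div h1 hne).congr_deriv ?_
  simp only [id]
  ring

theorem abs_deriv_silu_le (t : ℝ) :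
    |(1 + Real.exp (-t) + t * Real.exp (-t)) / (1 + Real.exp (-t)) ^ 2| ≤ 5 / 4 := by
  have he : 0 < Real.exp (-t) := Real.exp_pos _
  have hprod : Real.exp t * Real.exp (-t) = 1 := by rw [← Real.exp_add]; simp
  rw [abs_div, abs_of_pos (by positivity : 0 < (1 + Real.exp (-t)) ^ 2),
    div_le_iff₀ (by positivity), abs_le]
  constructor
  -- With `e = exp (-t)` this gives `t * e ≥ e - e²`, which suffices for the lower bound.
  · have h : -t + 1 ≤ Real.exp (-t) := Real.add_one_le_exp _
    nlinarith [mul_le_mul_of_nonneg_right h he.le]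
  -- The upper bound follows from `4 * t * e ≤ 1 + 6 * e`; multiplying by `exp t` gives this form.
  · have h : 4 * t - 6 ≤ Real.exp t := by
      rcases le_or_gt 0 t with ht | ht
      · nlinarith [Real.quadratic_le_exp_of_nonneg ht, sq_nonneg (t - 3)]
      · linarith [Real.exp_pos t]
    nlinarith [mul_le_mul_of_nonneg_right h he.le]

theorem abs_silu_sub_le (s t : ℝ) : |silu s - silu t| ≤ 5 / 4 * |s - t| := by
  have h := convex_univ.norm_image_sub_le_of_norm_hasDerivWithin_le (f := silu) (C := 5 / 4)
    (fun x _ => (hasDerivAt_silu x).hasDerivWithinAt) (fun x _ => abs_deriv_silu_le x)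
    (Set.mem_univ t) (Set.mem_univ s)
  simpa using h

/-- The function `x ↦ √(‖x‖² + ε)` is `1`-Lipschitz. -/
theorem abs_sqrt_norm_sq_add_sub_le {E : Type*} [SeminormedAddCommGroup E] (x y : E) {ε : ℝ}
    (hε : 0 < ε) : |√(‖x‖ ^ 2 + ε) - √(‖y‖ ^ 2 + ε)| ≤ ‖x - y‖ := by
  have hx : 0 < √(‖x‖ ^ 2 + ε) := by positivity
  have hy : 0 < √(‖y‖ ^ 2 + ε) := by positivity
  have hx2 : √(‖x‖ ^ 2 + ε) ^ 2 = ‖x‖ ^ 2 + ε := Real.sq_sqrt (by positivity)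
  have hy2 : √(‖y‖ ^ 2 + ε) ^ 2 = ‖y‖ ^ 2 + ε := Real.sq_sqrt (by positivity)
  have hxl : ‖x‖ ≤ √(‖x‖ ^ 2 + ε) := Real.le_sqrt_of_sq_le (by linarith)
  have hyl : ‖y‖ ≤ √(‖y‖ ^ 2 + ε) := Real.le_sqrt_of_sq_le (by linarith)
  refine le_trans ?_ (abs_norm_sub_norm_le x y)
  -- Both sides are the difference of squares, in which `ε` cancels; the sum of the roots dominates
  -- the sum of the norms.
  have hmul : |√(‖x‖ ^ 2 + ε) - √(‖y‖ ^ 2 + ε)| * (√(‖x‖ ^ 2 + ε) + √(‖y‖ ^ 2 + ε))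
      = |‖x‖ - ‖y‖| * (‖x‖ + ‖y‖) := by
    have h1 := abs_of_pos (add_pos hx hy)
    have h2 := abs_of_nonneg (add_nonneg (norm_nonneg x) (norm_nonneg y))
    conv_lhs => rw [← h1, ← abs_mul]
    conv_rhs => rw [← h2, ← abs_mul]
    congr 1
    linear_combination hx2 - hy2
  refine le_of_mul_le_mul_right (hmul.trans_le ?_) (add_pos hx hy)
  gcongr

/-! ### Group normalization is Lipschitz in the sup norm. -/

namespace GroupNorm

variable {n : ℕ} (N : GroupNorm n)

theorem lip_nonneg : 0 ≤ N.lip := by unfold lip; positivity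

theorem mem_group_self (c : Fin n) : c ∈ N.group c := by simp [group]

theorem card_group_pos (c : Fin n) : (0 : ℝ) < ((N.group c).card : ℝ) :=
  Nat.cast_pos.2 (Finset.card_pos.2 ⟨c, N.mem_group_self c⟩)

theorem mean_sub (v w : Fin n → ℝ) (c : Fin n) :
    N.mean v c - N.mean w c = N.mean (v - w) c := by
  simp only [mean, Pi.sub_apply, Finset.sum_sub_distrib, sub_div]

theorem abs_mean_le {v : Fin n → ℝ} {D : ℝ} (hv : ∀ c, |v c| ≤ D) (c : Fin n) :
    |N.mean v c| ≤ D := by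
  rw [mean, abs_div, abs_of_pos (N.card_group_pos c), div_le_iff₀ (N.card_group_pos c), mul_comm,
    ← nsmul_eq_mul]
  exact (Finset.abs_sum_le_sum_abs _ _).trans (Finset.sum_le_card_nsmul _ _ _ fun c' _ => hv c')

/-- The deviations from the mean in the channel group of `c`, divided by the square root of the
size of the group. -/
noncomputable def deviation (v : Fin n → ℝ) (c : Fin n) : EuclideanSpace ℝ (N.group c) :=
  WithLp.toLp 2 fun c' => (v c' - N.mean v c) / √((N.group c).card : ℝ)

theorem deviation_sub (v w : Fin n → ℝ) (c : Fin n) :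
    N.deviation v c - N.deviation w c = N.deviation (v - w) c := by
  ext c'
  simp only [deviation, PiLp.sub_apply, ← N.mean_sub, Pi.sub_apply]
  ring

theorem norm_deviation_sq (v : Fin n → ℝ) (c : Fin n) :
    ‖N.deviation v c‖ ^ 2 = N.variance v c := by
  rw [EuclideanSpace.real_norm_sq_eq, variance]
  simp only [deviation, div_pow, Real.sq_sqrt (Nat.cast_nonneg _), ← Finset.sum_div]
  rw [Finset.sum_coe_sort (N.group c) fun c' => (v c' - N.mean v c) ^ 2]

theorem variance_eq (v : Fin n → ℝ) (c : Fin n) :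
    N.variance v c = (∑ c' ∈ N.group c, v c' ^ 2) / ((N.group c).card : ℝ) - N.mean v c ^ 2 := by
  have hpos := N.card_group_pos c
  have hsum : ∑ c' ∈ N.group c, v c' = N.mean v c * ((N.group c).card : ℝ) := by
    rw [mean, div_mul_cancel₀ _ hpos.ne']
  simp only [variance, sub_sq, Finset.sum_add_distrib, Finset.sum_sub_distrib, ← Finset.sum_mul,
    ← Finset.mul_sum, Finset.sum_const, nsmul_eq_mul, hsum]
  field_simp
  ring

theorem variance_le {v : Fin n → ℝ} {D : ℝ} (hv : ∀ c, |v c| ≤ D) (c : Fin n) :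
    N.variance v c ≤ D ^ 2 := by
  rw [variance_eq]
  have h : (∑ c' ∈ N.group c, v c' ^ 2) / ((N.group c).card : ℝ) ≤ D ^ 2 := by
    rw [div_le_iff₀ (N.card_group_pos c), mul_comm, ← nsmul_eq_mul]
    exact Finset.sum_le_card_nsmul _ _ _ fun c' _ => sq_le_sq' (abs_le.1 (hv c')).1
      (abs_le.1 (hv c')).2
  linarith [sq_nonneg (N.mean v c)]

/-- The square of one deviation is a single summand of group size times variance. This is the source
of `√n` in `lip`. -/
theorem abs_sub_mean_le (v : Fin n → ℝ) (c : Fin n) :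
    |v c - N.mean v c| ≤ √(n : ℝ) * √(N.variance v c + N.ε) := by
  have hpos := N.card_group_pos c
  have hcard : ((N.group c).card : ℝ) ≤ n := by
    exact_mod_cast (Finset.card_le_univ _).trans_eq (Fintype.card_fin n)
  rw [← Real.sqrt_mul (Nat.cast_nonneg n)]
  refine Real.abs_le_sqrt ?_
  have h1 : (v c - N.mean v c) ^ 2 ≤ ∑ c' ∈ N.group c, (v c' - N.mean v c) ^ 2 :=
    Finset.single_le_sum (f := fun c' => (v c' - N.mean v c) ^ 2) (fun _ _ => sq_nonneg _)
      (N.mem_group_self c)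
  have h2 : ∑ c' ∈ N.group c, (v c' - N.mean v c) ^ 2 = (N.group c).card * N.variance v c := by
    rw [variance, mul_div_cancel₀ _ hpos.ne']
  have h3 : 0 ≤ N.variance v c := by rw [← norm_deviation_sq]; positivity
  calc (v c - N.mean v c) ^ 2 ≤ (N.group c).card * N.variance v c := h1.trans_eq h2
    _ ≤ n * (N.variance v c + N.ε) :=
      mul_le_mul hcard (by linarith [N.ε_pos]) h3 (Nat.cast_nonneg n)

theorem abs_apply_sub_le {v w : Fin n → ℝ} {D : ℝ} (h : ∀ c, |v c - w c| ≤ D) (c : Fin n) :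
    |N.apply v c - N.apply w c| ≤ N.lip * D := by
  have hD : 0 ≤ D := (abs_nonneg _).trans (h c)
  have hvar : ∀ u, 0 ≤ N.variance u c := fun u => by rw [← norm_deviation_sq]; positivity
  have hε := N.ε_pos
  have hεs : 0 < √N.ε := Real.sqrt_pos.2 hε
  have hsv : 0 < √(N.variance v c + N.ε) := Real.sqrt_pos.2 (by linarith [hvar v])
  have hsw : 0 < √(N.variance w c + N.ε) := Real.sqrt_pos.2 (by linarith [hvar w])
  have hswε : √N.ε ≤ √(N.variance w c + N.ε) := Real.sqrt_le_sqrt (by linarith [hvar w])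
  -- The variance is the squared norm of `deviation`, which is linear in `v`; the difference is
  -- therefore controlled by the variance of `v - w`, at most `D ^ 2`.
  have hs : |√(N.variance w c + N.ε) - √(N.variance v c + N.ε)| ≤ D := by
    rw [abs_sub_comm, ← norm_deviation_sq, ← norm_deviation_sq]
    refine (abs_sqrt_norm_sq_add_sub_le _ _ hε).trans ?_
    rw [deviation_sub]
    refine abs_le_of_sq_le_sq' ?_ hD |>.2
    rw [norm_deviation_sq]
    exact N.variance_le h c
  have hnum : |(v c - N.mean v c) - (w c - N.mean w c)| ≤ 2 * D := by
    have hm := N.abs_mean_le (v := v - w) h c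
    rw [← mean_sub] at hm
    have := abs_sub (v c - w c) (N.mean v c - N.mean w c)
    rw [show (v c - N.mean v c) - (w c - N.mean w c)
      = (v c - w c) - (N.mean v c - N.mean w c) by ring]
    linarith [h c]
  have key : |(v c - N.mean v c) / √(N.variance v c + N.ε)
      - (w c - N.mean w c) / √(N.variance w c + N.ε)| ≤ (2 + √(n : ℝ)) * D / √N.ε := by
    -- In this splitting the first quotient is bounded by `√n` whatever the size of `v`, so only the
    -- outer denominator costs a factor `1 / √ε`.
    have hsplit : (v c - N.mean v c) / √(N.variance v c + N.ε)
        - (w c - N.mean w c) / √(N.variance w c + N.ε)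
        = (((v c - N.mean v c) - (w c - N.mean w c))
          + (v c - N.mean v c) / √(N.variance v c + N.ε)
            * (√(N.variance w c + N.ε) - √(N.variance v c + N.ε)))
          / √(N.variance w c + N.ε) := by
      field_simp
      ring
    have hq : |(v c - N.mean v c) / √(N.variance v c + N.ε)| ≤ √(n : ℝ) := by
      rw [abs_div, abs_of_pos hsv, div_le_iff₀ hsv]
      exact N.abs_sub_mean_le v c
    rw [hsplit, abs_div, abs_of_pos hsw]
    refine div_le_div₀ (by positivity) ?_ hεs hswε
    refine (abs_add_le _ _).trans ?_
    rw [abs_mul, add_mul]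
    exact add_le_add hnum (mul_le_mul hq hs (abs_nonneg _) (Real.sqrt_nonneg _))
  have hγ : |N.γ c| ≤ ‖N.γ‖ := norm_le_pi_norm N.γ c
  rw [apply, apply, add_sub_add_right_eq_sub, ← mul_sub, abs_mul]
  refine (mul_le_mul hγ key (abs_nonneg _) (norm_nonneg _)).trans_eq ?_
  rw [lip]
  ring

end GroupNorm

namespace PreAct

variable {n : ℕ} (P : PreAct n)

theorem lip_nonneg : 0 ≤ P.lip := by
  rcases P with ⟨_ | N, act⟩
  · cases act <;> norm_num [lip]
  · have := N.lip_nonneg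
    simp only [lip]
    positivity

theorem abs_apply_sub_le {v w : Fin n → ℝ} {D : ℝ} (h : ∀ c, |v c - w c| ≤ D) (c : Fin n) :
    |P.apply v c - P.apply w c| ≤ P.lip * D := by
  have hact : ∀ (x y B : ℝ) (act : Bool), |x - y| ≤ B →
      |(if act then silu x else x) - (if act then silu y else y)|
        ≤ (if act then 5 / 4 else 1) * B := by
    rintro x y B (_ | _) hxy
    · simpa using hxy
    · simpa using (abs_silu_sub_le x y).trans (mul_le_mul_of_nonneg_left hxy (by norm_num))
  rcases P with ⟨_ | N, act⟩
  · simpa only [apply, lip, one_mul] using hact _ _ _ act (h c)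
  · have := hact _ _ _ act (N.abs_apply_sub_le h c)
    simp only [apply, lip]
    linarith

end PreAct

/-! ### Propagation of local closeness through the layers -/

/-- On the closed balls of radius `ρ` around `x` and `x'`, the values of `f` and `f'` differ by at
most `D`. -/
def CloseNear (ρ D : ℝ) (x x' : Plane) (f f' : Plane → ℝ) : Prop :=
  ∀ z z', dist z x ≤ ρ → dist z' x' ≤ ρ → |f z - f' z'| ≤ D

theorem norm_plane_le {a b B : ℝ} (ha : |a| ≤ B) (hb : |b| ≤ B) :
    ‖(!₂[a, b] : Plane)‖ ≤ √2 * B := by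
  have hB : 0 ≤ B := (abs_nonneg a).trans ha
  rw [EuclideanSpace.norm_eq, Fin.sum_univ_two, ← Real.sqrt_sq hB,
    ← Real.sqrt_mul (by norm_num : (0 : ℝ) ≤ 2)]
  refine Real.sqrt_le_sqrt ?_
  have h1 := sq_le_sq' (abs_le.1 ha).1 (abs_le.1 ha).2
  have h2 := sq_le_sq' (abs_le.1 hb).1 (abs_le.1 hb).2
  simp only [Real.norm_eq_abs, sq_abs]
  simp
  linarith

/-- A bound for the norms of the points of the centred `p × p` grid. -/
noncomputable def gridRadius (p : ℕ) (δ : ℝ) : ℝ := √2 * (((p : ℝ) - 1) / 2 * δ)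

theorem norm_gridPoint_le {p : ℕ} {δ : ℝ} (hδ : 0 < δ) (u v : Fin p) :
    ‖gridPoint δ u v‖ ≤ gridRadius p δ := by
  have key : ∀ u : Fin p, |((u : ℝ) - ((p : ℝ) - 1) / 2) * δ| ≤ ((p : ℝ) - 1) / 2 * δ := by
    intro u
    have h0 : (0 : ℝ) ≤ (u : ℕ) := Nat.cast_nonneg _
    have h1 : ((u : ℕ) : ℝ) + 1 ≤ p := by exact_mod_cast u.2
    rw [abs_mul, abs_of_pos hδ]
    refine mul_le_mul_of_nonneg_right (abs_le.2 ⟨?_, ?_⟩) hδ.le <;> linarith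
  exact norm_plane_le (key u) (key v)

/-- In each coordinate the corner is one of the two consecutive grid values enclosing that of `x`,
so it is off by at most `δ`. -/
theorem dist_corner_le {δ : ℝ} (hδ : 0 < δ) (x : Plane) (v u : Fin 2) :
    dist (corner δ x v u) x ≤ √2 * δ := by
  have key : ∀ (t : ℝ) (v : Fin 2), |((⌊t / δ⌋ : ℝ) + ((v : ℕ) : ℝ)) * δ - t| ≤ δ := by
    intro t v
    have h0 : (0 : ℝ) ≤ (v : ℕ) := Nat.cast_nonneg _
    have h1 : ((v : ℕ) : ℝ) ≤ 1 := by exact_mod_cast Nat.lt_succ_iff.1 v.2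
    have h2 := Int.floor_le (t / δ)
    have h3 := (Int.lt_floor_add_one (t / δ)).le
    have ht : t / δ * δ = t := div_mul_cancel₀ t hδ.ne'
    rw [abs_le]
    constructor <;> nlinarith
  have hx : corner δ x v u - x = !₂[((⌊x 0 / δ⌋ : ℝ) + ((v : ℕ) : ℝ)) * δ - x 0,
      ((⌊x 1 / δ⌋ : ℝ) + ((u : ℕ) : ℝ)) * δ - x 1] := by
    ext i
    fin_cases i <;> simp [corner]
  rw [dist_eq_norm, hx]
  exact norm_plane_le (key _ v) (key _ u)

theorem dist_corner_le_of_dist_le {δ ρ : ℝ} (hδ : 0 < δ) {x z : Plane} (hz : dist z x ≤ ρ)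
    (v u : Fin 2) : dist (corner δ z v u) x ≤ ρ + √2 * δ := by
  linarith [dist_triangle (corner δ z v u) z x, dist_corner_le hδ z v u]

section Layers

variable {ρ D δ : ℝ} {x x' : Plane} {m n n' p : ℕ}

theorem CloseNear.preAct (P : PreAct n) {f f' : Fin n → Plane → ℝ}
    (h : ∀ c, CloseNear ρ D x x' (f c) (f' c)) (c : Fin n) :
    CloseNear ρ (P.lip * D) x x' (fun z => P.apply (fun c' => f c' z) c)
      (fun z => P.apply (fun c' => f' c' z) c) :=
  fun z z' hz hz' => P.abs_apply_sub_le (fun c' => h c' z z' hz hz') c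

/-- A convolution with a `p × p` filter that is bounded by `F`. -/
theorem CloseNear.conv {F : ℝ} {f f' : Plane → ℝ} (hδ : 0 < δ) {k : Fin p → Fin p → ℝ}
    (hk : ∀ u v, |k u v| ≤ F) (h : CloseNear (ρ + gridRadius p δ) D x x' f f') :
    CloseNear ρ ((p : ℝ) ^ 2 * F * D) x x'
      (fun z => ∑ u : Fin p, ∑ v : Fin p, k u v * f (z - gridPoint δ u v))
      (fun z => ∑ u : Fin p, ∑ v : Fin p, k u v * f' (z - gridPoint δ u v)) := by
  intro z z' hz hz'
  have hd : ∀ {z x : Plane}, dist z x ≤ ρ → ∀ u v : Fin p,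
      dist (z - gridPoint δ u v) x ≤ ρ + gridRadius p δ := by
    intro z x hz u v
    have h1 := dist_triangle (z - gridPoint δ u v) z x
    have h2 : dist (z - gridPoint δ u v) z = ‖gridPoint δ u v‖ := by
      rw [dist_eq_norm, sub_sub_cancel_left, norm_neg]
    linarith [norm_gridPoint_le hδ u v]
  simp only [← Finset.sum_sub_distrib, ← mul_sub]
  have hterm : ∀ u v, |k u v * (f (z - gridPoint δ u v) - f' (z' - gridPoint δ u v))| ≤ F * D :=
    fun u v => by
      rw [abs_mul]
      exact mul_le_mul (hk u v) (h _ _ (hd hz u v) (hd hz' u v)) (abs_nonneg _)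
        ((abs_nonneg _).trans (hk u v))
  calc |∑ u, ∑ v, k u v * (f (z - gridPoint δ u v) - f' (z' - gridPoint δ u v))|
      ≤ ∑ u : Fin p, ∑ v : Fin p, F * D :=
        (Finset.abs_sum_le_sum_abs _ _).trans (Finset.sum_le_sum fun u _ =>
          (Finset.abs_sum_le_sum_abs _ _).trans (Finset.sum_le_sum fun v _ => hterm u v))
    _ = (p : ℝ) ^ 2 * F * D := by
        simp only [Finset.sum_const, Finset.card_univ, Fintype.card_fin, nsmul_eq_mul]
        ring

theorem CloseNear.sum {ι : Type*} [Fintype ι] {f f' : ι → Plane → ℝ}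
    (h : ∀ i, CloseNear ρ D x x' (f i) (f' i)) :
    CloseNear ρ (Fintype.card ι * D) x x' (fun z => ∑ i, f i z) (fun z => ∑ i, f' i z) := by
  intro z z' hz hz'
  simp only [← Finset.sum_sub_distrib]
  refine (Finset.abs_sum_le_sum_abs _ _).trans ?_
  rw [← nsmul_eq_mul]
  exact Finset.sum_le_card_nsmul _ _ _ fun i _ => h i z z' hz hz'

theorem CloseNear.liftConv {F : ℝ} (hδ : 0 < δ) {ψ : Fin n' → Fin n → Plane → ℝ}
    (hψ : ∀ c c' y, |ψ c c' y| ≤ F) {r r' : Image n}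
    (h : ∀ c, CloseNear (ρ + gridRadius p δ) D x x' (r c) (r' c)) (c : Fin n') (g : ZMod m) :
    CloseNear ρ ((n : ℝ) * ((p : ℝ) ^ 2 * F * D)) x x'
      (ReDiffuse.liftConv p δ ψ r c g) (ReDiffuse.liftConv p δ ψ r' c g) := by
  have key := CloseNear.sum fun c' => (h c').conv hδ fun u v =>
    hψ c c' (rot (-groupAngle g) (gridPoint δ u v))
  simp only [Fintype.card_fin] at key
  exact key

theorem CloseNear.groupConv [NeZero m] {F : ℝ} (hδ : 0 < δ)
    {φ : Fin n' → Fin n → ZMod m → Plane → ℝ} (hφ : ∀ c c' A y, |φ c c' A y| ≤ F)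
    {f f' : Feature m n}
    (h : ∀ c g, CloseNear (ρ + gridRadius p δ) D x x' (f c g) (f' c g)) (c : Fin n') (g : ZMod m) :
    CloseNear ρ ((n : ℝ) * (m * ((p : ℝ) ^ 2 * F * D))) x x'
      (ReDiffuse.groupConv p δ φ f c g) (ReDiffuse.groupConv p δ φ f' c g) := by
  have key := CloseNear.sum fun c' => CloseNear.sum fun A => (h c' (g + A)).conv hδ fun u v =>
    hφ c c' A (rot (-groupAngle g) (gridPoint δ u v))
  simp only [Fintype.card_fin, ZMod.card] at key
  exact key

theorem CloseNear.projConv [NeZero m] {F : ℝ} (hδ : 0 < δ)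
    {υ : Fin n' → Fin n → Plane → ℝ} (hυ : ∀ c c' y, |υ c c' y| ≤ F) {f f' : Feature m n}
    (h : ∀ c g, CloseNear (ρ + gridRadius p δ) D x x' (f c g) (f' c g)) (c : Fin n') :
    CloseNear ρ ((n : ℝ) * (m * ((p : ℝ) ^ 2 * F * D))) x x'
      (ReDiffuse.projConv p δ υ f c) (ReDiffuse.projConv p δ υ f' c) := by
  have key := CloseNear.sum fun c' => CloseNear.sum fun A => (h c' A).conv hδ fun u v =>
    hυ c c' (rot (-groupAngle A) (gridPoint δ u v))
  simp only [Fintype.card_fin, ZMod.card] at key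
  exact key

theorem CloseNear.maxPool (hδ : 0 < δ) {f f' : Feature m n}
    (h : ∀ c g, CloseNear (ρ + √2 * δ) D x x' (f c g) (f' c g)) (c : Fin n) (g : ZMod m) :
    CloseNear ρ D x x' (ReDiffuse.maxPool δ f c g) (ReDiffuse.maxPool δ f' c g) := by
  intro z z' hz hz'
  have hq : ∀ q : Fin 2 × Fin 2,
      |f c g (corner δ z q.1 q.2) - f' c g (corner δ z' q.1 q.2)| ≤ D := fun q =>
    h c g _ _ (dist_corner_le_of_dist_le hδ hz _ _) (dist_corner_le_of_dist_le hδ hz' _ _)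
  rw [abs_sub_le_iff, sub_le_iff_le_add, sub_le_iff_le_add]
  constructor <;> refine Finset.sup'_le _ _ fun q _ => ?_
  · have := Finset.le_sup' (fun q : Fin 2 × Fin 2 => f' c g (corner δ z' q.1 q.2))
      (Finset.mem_univ q)
    simp only [ReDiffuse.maxPool]
    linarith [(abs_le.1 (hq q)).2]
  · have := Finset.le_sup' (fun q : Fin 2 × Fin 2 => f c g (corner δ z q.1 q.2))
      (Finset.mem_univ q)
    simp only [ReDiffuse.maxPool]
    linarith [(abs_le.1 (hq q)).1]

theorem CloseNear.maxPools (hδ : 0 < δ) (s : ℕ) {f f' : Feature m n}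
    (h : ∀ c g, CloseNear (ρ + s * (√2 * δ)) D x x' (f c g) (f' c g)) (c : Fin n) (g : ZMod m) :
    CloseNear ρ D x x' (ReDiffuse.maxPools δ s f c g) (ReDiffuse.maxPools δ s f' c g) := by
  induction s generalizing f f' with
  | zero => simpa [ReDiffuse.maxPools] using h c g
  | succ s ih =>
    -- The innermost pooling is split off, so the induction varies the maps and keeps `ρ`.
    simp only [ReDiffuse.maxPools, Function.iterate_succ, Function.comp_apply] at ih ⊢
    refine ih fun c g => CloseNear.maxPool hδ (fun c g => ?_) c g
    convert h c g using 1
    push_cast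
    ring

theorem Weights.sum_mul_le (W : Weights) {z : Plane} {y : Fin 2 → Fin 2 → ℝ} {B : ℝ}
    (h : ∀ v u, y v u ≤ B) : ∑ v, ∑ u, W.lam v u z * y v u ≤ B :=
  calc ∑ v, ∑ u, W.lam v u z * y v u ≤ ∑ v, ∑ u, W.lam v u z * B :=
        Finset.sum_le_sum fun v _ => Finset.sum_le_sum fun u _ =>
          mul_le_mul_of_nonneg_left (h v u) (W.nonneg v u z)
    _ = B := by simp only [← Finset.sum_mul, W.sum_eq_one, one_mul]

/-- Two weighted means with different weights are as close as the values that are averaged. -/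
theorem Weights.sum_mul_sub_le (W : Weights) {z z' : Plane} {y y' : Fin 2 → Fin 2 → ℝ} {D : ℝ}
    (h : ∀ v u v' u', y v u - y' v' u' ≤ D) :
    ∑ v, ∑ u, W.lam v u z * y v u - ∑ v, ∑ u, W.lam v u z' * y' v u ≤ D := by
  set M := ∑ v, ∑ u, W.lam v u z * y v u
  have h1 : ∀ v' u', M ≤ y' v' u' + D := fun v' u' =>
    W.sum_mul_le fun v u => by linarith [h v u v' u']
  -- The first mean is within `D` above every single value `y'`; averaging the negated values with
  -- the second weights finishes.
  have h2 : ∑ v, ∑ u, W.lam v u z' * -(y' v u) ≤ D - M :=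
    W.sum_mul_le fun v u => by linarith [h1 v u]
  simp only [mul_neg, Finset.sum_neg_distrib] at h2
  linarith

theorem CloseNear.interp (hδ : 0 < δ) (W : Weights) {f f' : Feature m n}
    (h : ∀ c g, CloseNear (ρ + √2 * δ) D x x' (f c g) (f' c g)) (c : Fin n) (g : ZMod m) :
    CloseNear ρ D x x' (ReDiffuse.interp δ W f c g) (ReDiffuse.interp δ W f' c g) := by
  intro z z' hz hz'
  -- The weights at `z` and `z'` are unrelated, so all pairs of corners must be compared;
  -- `CloseNear` allows this.
  have hq : ∀ v u v' u', |f c g (corner δ z v u) - f' c g (corner δ z' v' u')| ≤ D :=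
    fun v u v' u' =>
      h c g _ _ (dist_corner_le_of_dist_le hδ hz v u) (dist_corner_le_of_dist_le hδ hz' v' u')
  exact abs_sub_le_iff.2
    ⟨W.sum_mul_sub_le fun v u v' u' => (abs_sub_le_iff.1 (hq v u v' u')).1,
      W.sum_mul_sub_le fun v u v' u' => (abs_sub_le_iff.1 (hq v' u' v u)).2⟩

theorem CloseNear.interps (hδ : 0 < δ) (W : ℕ → Weights) (s : ℕ) {f f' : Feature m n}
    (h : ∀ c g, CloseNear (ρ + s * (√2 * δ)) D x x' (f c g) (f' c g)) (c : Fin n) (g : ZMod m) :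
    CloseNear ρ D x x' (ReDiffuse.interps δ W f s c g) (ReDiffuse.interps δ W f' s c g) := by
  induction s generalizing ρ c g with
  | zero => simpa [ReDiffuse.interps] using h c g
  | succ s ih =>
    -- Here the outermost interpolation is split off, so the induction hypothesis is used at the
    -- radius enlarged by `√2 * δ`.
    refine CloseNear.interp hδ _ (fun c g => ih (fun c g => ?_) c g) c g
    convert h c g using 1
    push_cast
    ring

end Layers

/-! ### Composition of the stages, with bookkeeping of radius and gain. -/

namespace Network

variable {m a b d p : ℕ} {ch n : ℕ → ℕ} [NeZero m] {net : Network m a b d ch}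
  {ρ D δ : ℝ} {x x' : Plane} {F G H : ℕ → ℝ}

/-- The partial product `gain s` is kept in the hypothesis so that the conclusion of one stage is
literally the hypothesis of the next. -/
theorem closeNear_layers (hδ : 0 < δ)
    (hn : ∀ l, 1 ≤ l → l < numLayers a b d → n l = m * ch l)
    (hnet : net.FiltersBounded p δ F G H) {s t : ℕ} (hs : 1 ≤ s)
    (hst : s + t < numLayers a b d) {f f' : Feature m (ch s)}
    (h : ∀ c g, CloseNear (ρ + t * gridRadius p δ)
      (gain s p n F (fun l => (net.pre l).lip) * D) x x' (f c g) (f' c g))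
    (c : Fin (ch (s + t))) (g : ZMod m) :
    CloseNear ρ (gain (s + t) p n F (fun l => (net.pre l).lip) * D) x x'
      (net.layers p δ s f t c g) (net.layers p δ s f' t c g) := by
  induction t generalizing ρ g with
  | zero => simpa [layers] using h c g
  | succ t ih =>
    have hprev := fun c g => ih (ρ := ρ + gridRadius p δ) (by omega) (fun c g => by
      convert h c g using 1
      push_cast
      ring) c g
    have key := CloseNear.groupConv hδ
      (f := (net.pre (s + t)).onFeature (net.layers p δ s f t))
      (f' := (net.pre (s + t)).onFeature (net.layers p δ s f' t))
      (fun c c' A y => (((hnet.2.1 (s + t) (by omega) (by omega) c c' A).1).2.2 y).1)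
      (fun c g => CloseNear.preAct (net.pre (s + t)) (fun c => hprev c g) c) c g
    -- The sums over channels and over the group contribute `ch (s + t)` and `m`, together the
    -- factor `n (s + t)` of the gain.
    refine fun z z' hz hz' => (key z z' hz hz').trans_eq ?_
    rw [gain, gain, ← add_assoc, Finset.prod_range_succ, hn (s + t) (by omega) (by omega)]
    push_cast
    ring

theorem closeNear_inputStage (hδ : 0 < δ) (hn0 : n 0 = ch 0)
    (hn : ∀ l, 1 ≤ l → l < numLayers a b d → n l = m * ch l)
    (hnet : net.FiltersBounded p δ F G H) {r r' : Image (ch 0)}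
    (h : ∀ c, CloseNear (ρ + (a + 1) * gridRadius p δ) D x x' (r c) (r' c))
    (c : Fin (ch (1 + a))) (g : ZMod m) :
    CloseNear ρ (gain (1 + a) p n F (fun l => (net.pre l).lip) * D) x x'
      (net.inputStage p δ r c g) (net.inputStage p δ r' c g) := by
  refine closeNear_layers hδ hn hnet le_rfl (by rw [numLayers]; omega) (fun c g => ?_) c g
  have key := CloseNear.liftConv (ρ := ρ + a * gridRadius p δ) hδ
    (r := (net.pre 0).onImage r) (r' := (net.pre 0).onImage r')
    (fun c c' y => (((hnet.1 c c').1).2.2 y).1)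
    (fun c => CloseNear.preAct (net.pre 0) (fun c => by
      convert h c using 1
      ring) c) c g
  refine fun z z' hz hz' => (key z z' hz hz').trans_eq ?_
  rw [gain, Finset.prod_range_one, hn0]
  ring

theorem closeNear_outputStage (hδ : 0 < δ)
    (hn : ∀ l, 1 ≤ l → l < numLayers a b d → n l = m * ch l)
    (hnet : net.FiltersBounded p δ F G H) {f f' : Feature m (ch (1 + a + b))}
    (h : ∀ c g, CloseNear (ρ + (d + 1) * gridRadius p δ)
      (gain (1 + a + b) p n F (fun l => (net.pre l).lip) * D) x x' (f c g) (f' c g))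
    (c : Fin (ch (numLayers a b d))) :
    CloseNear ρ (gain (numLayers a b d) p n F (fun l => (net.pre l).lip) * D) x x'
      (net.outputStage p δ f c) (net.outputStage p δ f' c) := by
  have hlayers := fun c g => closeNear_layers (ρ := ρ + gridRadius p δ) (s := 1 + a + b) (t := d)
    (D := D) hδ hn hnet (by omega) (by rw [numLayers]; omega) (fun c g => by
      convert h c g using 1
      ring) c g
  have key := CloseNear.projConv hδ
    (f := (net.pre (1 + a + b + d)).onFeature (net.layers p δ (1 + a + b) f d))
    (f' := (net.pre (1 + a + b + d)).onFeature (net.layers p δ (1 + a + b) f' d))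
    (fun c c' y => (((hnet.2.2 c c').1).2.2 y).1)
    (fun c g => CloseNear.preAct (net.pre (1 + a + b + d)) (fun c => hlayers c g) c) c
  refine fun z z' hz hz' => (key z z' hz hz').trans_eq ?_
  rw [gain, gain, numLayers, Finset.prod_range_succ,
    hn (1 + a + b + d) (by omega) (by rw [numLayers]; omega)]
  push_cast
  ring

/-- The output of the network at `x` depends on the input near `x` only. -/
theorem closeNear_eval (hδ : 0 < δ) (hn0 : n 0 = ch 0)
    (hn : ∀ l, 1 ≤ l → l < numLayers a b d → n l = m * ch l)
    (hnet : net.FiltersBounded p δ F G H) (s : ℕ) {r r' : Image (ch 0)}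
    (h : ∀ c, CloseNear (ρ + numLayers a b d * gridRadius p δ + 2 * s * (√2 * δ)) D x x'
      (r c) (r' c))
    (c : Fin (ch (numLayers a b d))) :
    CloseNear ρ (gain (numLayers a b d) p n F (fun l => (net.pre l).lip) * D) x x'
      (net.eval p δ s r c) (net.eval p δ s r' c) := by
  refine closeNear_outputStage hδ hn hnet (fun c g => CloseNear.interps hδ _ s
    (fun c g => closeNear_layers hδ hn hnet (by omega) (by rw [numLayers]; omega)
      (fun c g => CloseNear.maxPools hδ s
        (fun c g => closeNear_inputStage hδ hn0 hn hnet (fun c => ?_) c g) c g) c g) c g) c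
  convert h c using 1
  rw [numLayers]
  push_cast
  ring

end Network

/-! ### Rotations -/

theorem norm_rot (θ : ℝ) (x : Plane) : ‖rot θ x‖ = ‖x‖ := by
  rw [EuclideanSpace.norm_eq, EuclideanSpace.norm_eq, Fin.sum_univ_two, Fin.sum_univ_two]
  congr 1
  simp only [Real.norm_eq_abs, sq_abs, rot]
  simp
  linear_combination (x 0 ^ 2 + x 1 ^ 2) * Real.sin_sq_add_cos_sq θ

theorem rot_sub (θ : ℝ) (x y : Plane) : rot θ (x - y) = rot θ x - rot θ y := by
  ext i
  fin_cases i <;> simp [rot] <;> ring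

theorem dist_rot (θ : ℝ) (x y : Plane) : dist (rot θ x) (rot θ y) = dist x y := by
  rw [dist_eq_norm, dist_eq_norm, ← rot_sub, norm_rot]

theorem HasBounds.abs_sub_le {F G H : ℝ} {f : Plane → ℝ} (hf : HasBounds F G H f) (x y : Plane) :
    |f x - f y| ≤ G * dist x y := by
  have h := convex_univ.norm_image_sub_le_of_norm_fderiv_le (f := f) (C := G) (𝕜 := ℝ)
    (fun x _ => hf.1 x) (fun x _ => ?_) (Set.mem_univ y) (Set.mem_univ x)
  · rwa [dist_eq_norm]
  · have := (hf.2.2 x).2.1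
    rwa [gradient, LinearIsometryEquiv.norm_map] at this

/-- The rotation carries the ball around `x` isometrically to the ball around `rot (-θ) x`, so `r c`
is evaluated at two points of one ball, at distance at most `2 * ρ`. -/
theorem HasBounds.closeNear_rotateImage {k : ℕ} {F G H : ℝ} {r : Image k}
    (hr : ∀ c, HasBounds F G H (r c)) (θ ρ : ℝ) (x : Plane) (c : Fin k) :
    CloseNear ρ (G * (2 * ρ)) x (rot (-θ) x) (rotateImage θ r c) (r c) := by
  intro z z' hz hz'
  have hG : 0 ≤ G := (norm_nonneg _).trans ((hr c).2.2 x).2.1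
  refine ((hr c).abs_sub_le _ _).trans (mul_le_mul_of_nonneg_left ?_ hG)
  have h1 := dist_triangle_right (rot (-θ) z) z' (rot (-θ) x)
  rw [dist_rot] at h1
  linarith

theorem gain_nonneg {N p : ℕ} {n : ℕ → ℕ} {F Λ : ℕ → ℝ} (hF : ∀ l < N, 0 ≤ F (l + 1))
    (hΛ : ∀ l, 0 ≤ Λ l) : 0 ≤ gain N p n F Λ :=
  Finset.prod_nonneg fun l hl => by
    have := hF l (Finset.mem_range.1 hl)
    have := hΛ l
    positivity

theorem IsFilter.bound_nonneg {p : ℕ} {δ F G H : ℝ} {f : Plane → ℝ} (hf : IsFilter p δ F G H f) :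
    0 ≤ F :=
  (abs_nonneg _).trans (hf.1.2.2 0).1

/-- Positive channel numbers guarantee that each layer has at least one filter, whose bound forces
the sign. -/
theorem Network.FiltersBounded.bound_nonneg {m a b d p : ℕ} {ch : ℕ → ℕ} [NeZero m]
    {net : Network m a b d ch} {δ : ℝ} {F G H : ℕ → ℝ} (hnet : net.FiltersBounded p δ F G H)
    (hch : ∀ l ≤ numLayers a b d, 0 < ch l) {l : ℕ} (hl : l < numLayers a b d) :
    0 ≤ F (l + 1) := by
  rcases Nat.eq_zero_or_pos l with rfl | hl0
  · exact (hnet.1 ⟨0, hch 1 hl⟩ ⟨0, hch 0 (Nat.zero_le _)⟩).bound_nonneg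
  rcases Nat.lt_or_ge (l + 1) (numLayers a b d) with hlt | hge
  · exact (hnet.2.1 l hl0 hlt ⟨0, hch _ hlt.le⟩ ⟨0, hch _ hl.le⟩ 0).bound_nonneg
  · rw [show l + 1 = numLayers a b d by omega]
    exact (hnet.2.2 ⟨0, hch _ le_rfl⟩
      ⟨0, hch _ (by rw [numLayers]; omega)⟩).bound_nonneg

end ReDiffuse

/-! ### The main estimate. -/

theorem mainTheorem2
    -- group order, numbers of convolutions in the stages, of pooling and of interpolation layers,
    -- filter size, image height and width, mesh size
    (m a b d s p h w : ℕ) [NeZero m] (hp : 0 < p) (δ : ℝ) (hδ : 0 < δ)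
    -- channels per orientation, and channel numbers of the layers
    (ch n : ℕ → ℕ) (hch : ∀ l < ReDiffuse.numLayers a b d, 0 < ch l)
    (hn0 : n 0 = ch 0) (hn : ∀ l, 1 ≤ l → l < ReDiffuse.numLayers a b d → n l = m * ch l)
    (net : ReDiffuse.Network m a b d ch) (F G H : ℕ → ℝ)
    (hnet : net.FiltersBounded p δ F G H)
    (r : ReDiffuse.Image (ch 0)) (hr : ∀ c, ReDiffuse.HasBounds (F 0) (G 0) (H 0) (r c))
    (θ : ℝ) (hθ : θ ∈ Set.Icc 0 (2 * Real.pi))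
    (c : Fin (ch (ReDiffuse.numLayers a b d))) (i : Fin w) (j : Fin h) :
    |net.eval p δ s (ReDiffuse.rotateImage θ r) c (ReDiffuse.gridPoint δ i j)
        - ReDiffuse.rotateImage θ (net.eval p δ s r) c (ReDiffuse.gridPoint δ i j)|
      ≤ ReDiffuse.C₁ a b d s p n F (G 0) (fun l => (net.pre l).lip) * δ
        + ReDiffuse.C₂ (ReDiffuse.numLayers a b d) h w p n F (G 0) (fun l => (net.pre l).lip)
          * (m : ℝ)⁻¹ * δ := by 
  open ReDiffuse in
  -- For the output layer, positivity comes from the existence of the channel `c`.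
  have hchN : ∀ l ≤ numLayers a b d, 0 < ch l := fun l hl =>
    (Nat.lt_or_eq_of_le hl).elim (hch l) fun h => h ▸ c.pos
  have hG : 0 ≤ G 0 := (norm_nonneg _).trans ((hr ⟨0, hchN 0 (Nat.zero_le _)⟩).2.2 0).2.1
  have hgain : 0 ≤ gain (numLayers a b d) p n F (fun l => (net.pre l).lip) :=
    gain_nonneg (fun l hl => hnet.bound_nonneg hchN hl) fun l => (net.pre l).lip_nonneg
  -- With `ρ = 0` the balls at the output are single points, and the input radius is the total reach
  -- of the network.
  have key := Network.closeNear_eval (ρ := 0) hδ hn0 hn hnet s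
    (fun c => HasBounds.closeNear_rotateImage hr θ _ (gridPoint δ i j) c) c
    (gridPoint δ i j) (rot (-θ) (gridPoint δ i j)) (dist_self _).le (dist_self _).le
  have hC₂ : 0 ≤ C₂ (numLayers a b d) h w p n F (G 0) (fun l => (net.pre l).lip)
      * (m : ℝ)⁻¹ * δ := by
    unfold C₂
    positivity
  refine (key.trans ?_).trans (le_add_of_nonneg_right hC₂)
  rw [C₁, gridRadius]
  set P := gain (numLayers a b d) p n F (fun l => (net.pre l).lip)
  -- This is the surplus of `C₁ * δ` over the bound in `key`, which needs only `N(p-1) + 4s` in the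
  -- bracket.
  have hextra : 0 ≤ √2 * (2 * s * b + 4 * s * d + 4 * s ^ 2 + 2 * s) * G 0 * P * δ := by
    positivity
  linarith
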